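/- Let $A,B,J$ be finite-dimensional complex Hilbert spaces, with $J\neq 0$, and let $\mathcal N:\mathcal L(A\otimes J)\to\mathcal L(B)$ be a completely positive trace-preserving map (a quantum arbitrarily varying channel, QAVC, with sender $A$, receiver $B$ and jammer $J$). Write $\mathcal S(X)$ for the set of states (density operators) on $X$, and $X^\ell=X^{\otimes\ell}$. For $\sigma\in\mathcal S(J)$ let $\mathcal N_\sigma(\rho)=\mathcal N(\rho\otimes\sigma)$. A classical code of block length $\ell$ is a collection $\mathcal C=\{(\rho_m,D_m):m=1,\dots,M\}$ with states $\rho_m\in\mathcal S(A^{\ell})$ and operators $D_m\ge 0$ on $B^{\ell}$ such that $\sum_{m=1}^M D_m=\mathbb 1$. Its error probability with respect to a jammer state $\zeta\in\mathcal S(J^{\ell})$ is \[ P_{\mathrm{err}}(\mathcal C,\zeta)=\frac1M\sum_{m=1}^M\operatorname{tr}\bigl(\mathcal N^{\otimes\ell}(\rho_m\otimes\zeta)\,(\mathbb 1-D_m)\bigr), \] where $A^\ell\otimes J^\ell$ is identified with $(A\otimes J)^{\otimes\ell}$. For a permutation $\pi\in S_\ell$ and any Hilbert space $X$, let $U^\pi$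 be the unitary on $X^{\ell}$ with $U^\pi(|\alpha_1\rangle\cdots|\alpha_\ell\rangle)=|\alpha_{\pi^{-1}(1)}\rangle\cdots|\alpha_{\pi^{-1}(\ell)}\rangle$. Let $\varepsilon\in\mathbb R$ and let $\mathcal C=\{(\rho_m,D_m):m=1,\dots,M\}$ be a code of block length $\ell$ with error probability at most $\varepsilon$ for the compound channel $\{\mathcal N_\sigma\}_{\sigma\in\mathcal S(J)}$, i.e. for all $\sigma\in\mathcal S(J)$, \[ P_{\mathrm{err}}(\mathcal C,\sigma^{\otimes\ell})=\frac1M\sum_{m=1}^M\operatorname{tr}\bigl(\mathcal N_\sigma^{\otimes\ell}(\rho_m)\,(\mathbb 1-D_m)\bigr)\le\varepsilon . \] Consider the random code $(\mathcal C_\pi)_{\pi\in S_\ell}$ with $\pi$ uniformly distributed on $S_\ell$ and \[ \mathcal C_\pi=\{(U^\pi\rho_mU^{\pi\dagger},\,U^\pi D_mU^{\pi\dagger}):m=1,\dots,M\}. \] Then for every state $\zeta\in\mathcal S(J^{\ell})$ (possibly entangled across the $\ell$ systems), \[ \mathbb E_\pi P_{\mathrm{err}}(\mathcal C_\pi,\zeta)\le\varepsilon\,(\ell+1)^{|J|^2},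 \] where $|J|=\dim J$. -/

import Mathlib

open scoped Matrix Kronecker ComplexOrder

namespace QAVC

noncomputable section

/-- Operators on the finite dimensional Hilbert space with orthonormal basis labelled by `X`. -/
abbrev Op (X : Type*) := Matrix X X ℂ

/-- A basis of the `ℓ`-fold tensor power: tuples of basis labels. -/
abbrev Pow (X : Type*) (ℓ : ℕ) := Fin ℓ → X

/-- Quantum states (density operators). -/
structure State (X : Type*) [Fintype X] where
  op : Op X
  posSemidef : op.PosSemidef
  trace_eq_one : op.trace = 1

/-- `id_k ⊗ T`, applied to an operator on `ℂ^k ⊗ X`. -/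
def ampliation {X Y : Type*} (T : Op X →ₗ[ℂ] Op Y) (k : ℕ) (P : Op (Fin k × X)) :
    Op (Fin k × Y) :=
  Matrix.of fun p q => T (Matrix.of fun x x' => P (p.1, x) (q.1, x')) p.2 q.2

/-- Complete positivity: all `id_k ⊗ T` preserve positive semidefiniteness. -/
def IsCompletelyPositive {X Y : Type*} [Fintype X] [Fintype Y] (T : Op X →ₗ[ℂ] Op Y) : Prop :=
  ∀ (k : ℕ) (P : Op (Fin k × X)), P.PosSemidef → (ampliation T k P).PosSemidef

/-- Completely positive and trace preserving maps. -/
structure Channel (X Y : Type*) [Fintype X] [Fintype Y] where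
  map : Op X →ₗ[ℂ] Op Y
  completelyPositive : IsCompletelyPositive map
  tracePreserving : ∀ P, (map P).trace = P.trace

/-- The product operator `P 0 ⊗ ⋯ ⊗ P (ℓ - 1)`. -/
def tensorOp {X : Type*} {ℓ : ℕ} (P : Fin ℓ → Op X) : Op (Pow X ℓ) :=
  Matrix.of fun x x' => ∏ i, P i (x i) (x' i)

/-- The tensor power `T^{⊗ℓ}` of a linear map, given by its values
on matrix units and linearity; see `tensorPowMap_tensorOp`. -/
def tensorPowMap {X Y : Type*} [Fintype X] [DecidableEq X] (T : Op X →ₗ[ℂ] Op Y) (ℓ : ℕ) :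
    Op (Pow X ℓ) →ₗ[ℂ] Op (Pow Y ℓ) where
  toFun P := Matrix.of fun y y' =>
    ∑ x, ∑ x', P x x' * ∏ i, T (Matrix.single (x i) (x' i) 1) (y i) (y' i)
  map_add' P Q := by
    ext y y'
    simp [add_mul, Finset.sum_add_distrib]
  map_smul' c P := by
    ext y y'
    simp [Finset.mul_sum, mul_assoc]

theorem map_apply_eq_sum {X Y : Type*} [Fintype X] [DecidableEq X] (T : Op X →ₗ[ℂ] Op Y)
    (P : Op X) (y y' : Y) :
    T P y y' = ∑ x, ∑ x', P x x' * T (Matrix.single x x' 1) y y' := by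
  conv_lhs => rw [Matrix.matrix_eq_sum_single P]
  simp only [map_sum, Matrix.sum_apply]
  refine Finset.sum_congr rfl fun x _ => Finset.sum_congr rfl fun x' _ => ?_
  have : Matrix.single x x' (P x x') = P x x' • Matrix.single x x' (1 : ℂ) := by simp
  rw [this, map_smul]
  simp

theorem prod_sum_sum {X : Type*} [Fintype X] {ℓ : ℕ} (f : Fin ℓ → X → X → ℂ) :
    ∏ i, ∑ x, ∑ x', f i x x' = ∑ x : Pow X ℓ, ∑ x' : Pow X ℓ, ∏ i, f i (x i) (x' i) := by
  classical
  rw [Finset.prod_univ_sum, Fintype.piFinset_univ]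
  refine Finset.sum_congr rfl fun x _ => ?_
  rw [Finset.prod_univ_sum, Fintype.piFinset_univ]

/-- `T^{⊗ℓ} (P 0 ⊗ ⋯ ⊗ P (ℓ - 1)) = T (P 0) ⊗ ⋯ ⊗ T (P (ℓ - 1))`. -/
theorem tensorPowMap_tensorOp {X Y : Type*} [Fintype X] [DecidableEq X]
    (T : Op X →ₗ[ℂ] Op Y) {ℓ : ℕ} (P : Fin ℓ → Op X) :
    tensorPowMap T ℓ (tensorOp P) = tensorOp fun i => T (P i) := by
  ext y y'
  simp only [tensorPowMap, tensorOp, LinearMap.coe_mk, AddHom.coe_mk, Matrix.of_apply]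
  simp_rw [map_apply_eq_sum T (P _), ← Finset.prod_mul_distrib]
  rw [prod_sum_sum]

theorem tensorOp_mul {X : Type*} [Fintype X] {ℓ : ℕ} (P Q : Fin ℓ → Op X) :
    tensorOp P * tensorOp Q = tensorOp fun i => P i * Q i := by
  classical
  ext x x'
  simp only [tensorOp, Matrix.mul_apply, Matrix.of_apply, ← Finset.prod_mul_distrib]
  rw [Finset.prod_univ_sum, Fintype.piFinset_univ]

theorem tensorOp_conjTranspose {X : Type*} {ℓ : ℕ} (P : Fin ℓ → Op X) :
    (tensorOp P)ᴴ = tensorOp fun i => (P i)ᴴ := by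
  ext x x'
  simp [tensorOp, Matrix.conjTranspose_apply]

section

open scoped MatrixOrder

theorem exists_eq_conjTranspose_mul_self {X : Type*} [Fintype X] {P : Op X}
    (hP : P.PosSemidef) : ∃ R : Op X, P = Rᴴ * R := by
  classical
  exact CStarAlgebra.nonneg_iff_eq_star_mul_self.mp hP.nonneg

end

/-- The i.i.d. state `σ^{⊗ℓ}`. -/
def State.pow {X : Type*} [Fintype X] (σ : State X) (ℓ : ℕ) : State (Pow X ℓ) where
  op := tensorOp fun _ => σ.op
  posSemidef := by
    classical
    obtain ⟨R, hR⟩ := exists_eq_conjTranspose_mul_self σ.posSemidef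
    rw [hR, ← tensorOp_mul, ← tensorOp_conjTranspose]
    exact Matrix.posSemidef_conjTranspose_mul_self _
  trace_eq_one := by
    classical
    have h := Finset.prod_univ_sum (fun _ : Fin ℓ => (Finset.univ : Finset X))
      (fun _ x => σ.op x x)
    rw [Fintype.piFinset_univ] at h
    simp only [Matrix.trace, Matrix.diag_apply, tensorOp, Matrix.of_apply]
    rw [← h]
    have := σ.trace_eq_one
    simp only [Matrix.trace, Matrix.diag_apply] at this
    simp [this]

section

variable {A B J : Type*} [Fintype A] [Fintype B] [Fintype J]
  [DecidableEq A] [DecidableEq B] [DecidableEq J]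

/-- `𝒩^{⊗ℓ} (ρ ⊗ σ)` for operators `ρ` on `A^ℓ` and `σ` on `J^ℓ`, where `A^ℓ ⊗ J^ℓ` is
identified with `(A ⊗ J)^ℓ` in the usual way. -/
def blockOutput (N : Channel (A × J) B) {ℓ : ℕ} (ρ : Op (Pow A ℓ)) (σ : Op (Pow J ℓ)) :
    Op (Pow B ℓ) :=
  tensorPowMap N.map ℓ
    (Matrix.reindex (Equiv.arrowProdEquivProdArrow (Fin ℓ) (fun _ => A) (fun _ => J)).symm
      (Equiv.arrowProdEquivProdArrow (Fin ℓ) (fun _ => A) (fun _ => J)).symm (ρ ⊗ₖ σ))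

/-- The map `𝒩_σ : ρ ↦ 𝒩 (ρ ⊗ σ)` obtained by fixing the jammer's state. -/
def fixJammer (N : Channel (A × J) B) (σ : State J) : Op A →ₗ[ℂ] Op B where
  toFun ρ := N.map (ρ ⊗ₖ σ.op)
  map_add' ρ ρ' := by rw [Matrix.add_kronecker, map_add]
  map_smul' c ρ := by rw [Matrix.smul_kronecker, map_smul, RingHom.id_apply]

/-- A deterministic classical code of block length `ℓ` with `M` messages. -/
structure Code (A B : Type*) [Fintype A] [Fintype B] [DecidableEq B] (ℓ M : ℕ) where
  enc : Fin M → State (Pow A ℓ)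
  dec : Fin M → Op (Pow B ℓ)
  dec_posSemidef : ∀ m, (dec m).PosSemidef
  dec_sum : ∑ m, dec m = 1

/-- The average error probability of a code for the QAVC `N`
with respect to a jammer state on `J^ℓ`. -/
def errorProb (N : Channel (A × J) B) {ℓ M : ℕ} (C : Code A B ℓ M) (σ : State (Pow J ℓ)) : ℝ :=
  (1 / (M : ℝ)) * ∑ m, (blockOutput N (C.enc m).op σ.op * (1 - C.dec m)).trace.re

/-- The average error probability of a code over the memoryless channel `T^{⊗ℓ}`. -/
def memorylessErrorProb (T : Op A →ₗ[ℂ] Op B) {ℓ M : ℕ} (C : Code A B ℓ M) : ℝ :=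
  (1 / (M : ℝ)) * ∑ m, (tensorPowMap T ℓ (C.enc m).op * (1 - C.dec m)).trace.re

/-- `C` has error probability at most `ε` for the compound channel `{𝒩_σ}`. -/
def HasCompoundError (N : Channel (A × J) B) {ℓ M : ℕ} (C : Code A B ℓ M) (ε : ℝ) : Prop :=
  ∀ σ : State J, memorylessErrorProb (fixJammer N σ) C ≤ ε

/-- `𝒩^{⊗ℓ} (ρ ⊗ σ^{⊗ℓ}) = (𝒩_σ)^{⊗ℓ} (ρ)`. -/
theorem blockOutput_pow (N : Channel (A × J) B) {ℓ : ℕ} (ρ : Op (Pow A ℓ)) (σ : State J) :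
    blockOutput N ρ (σ.pow ℓ).op = tensorPowMap (fixJammer N σ) ℓ ρ := by
  have key : ∀ (a a' : A) (b b' : B), fixJammer N σ (Matrix.single a a' 1) b b' =
      ∑ j, ∑ j', σ.op j j' * N.map (Matrix.single (a, j) (a', j') 1) b b' := by
    intro a a' b b'
    rw [fixJammer, LinearMap.coe_mk, AddHom.coe_mk, map_apply_eq_sum]
    simp only [Fintype.sum_prod_type, Matrix.kroneckerMap_apply, Matrix.single_apply]
    rw [Finset.sum_eq_single a (by intro x _ hx; simp [hx.symm]) (by simp)]
    refine Finset.sum_congr rfl fun j _ => ?_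
    rw [Finset.sum_eq_single a' (by intro x _ hx; simp [hx.symm]) (by simp)]
    simp
  ext b b'
  simp only [blockOutput, tensorPowMap, LinearMap.coe_mk, AddHom.coe_mk, Matrix.of_apply, key,
    prod_sum_sum]
  rw [← (Equiv.arrowProdEquivProdArrow (Fin ℓ) (fun _ => A) (fun _ => J)).symm.sum_comp]
  simp_rw [← (Equiv.arrowProdEquivProdArrow (Fin ℓ) (fun _ => A) (fun _ => J)).symm.sum_comp
    (fun x' => _ * ∏ i, _)]
  simp only [Fintype.sum_prod_type]
  refine Finset.sum_congr rfl fun a _ => ?_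
  rw [Finset.sum_comm]
  refine Finset.sum_congr rfl fun a' _ => ?_
  simp [Finset.mul_sum, State.pow, tensorOp, Equiv.arrowProdEquivProdArrow,
    Finset.prod_mul_distrib, mul_assoc]

theorem errorProb_pow (N : Channel (A × J) B) {ℓ M : ℕ} (C : Code A B ℓ M) (σ : State J) :
    errorProb N C (σ.pow ℓ) = memorylessErrorProb (fixJammer N σ) C := by
  simp only [errorProb, memorylessErrorProb, blockOutput_pow]

/-- A random code whose shared random variable takes values in a finite set. -/
structure RandomCode (Λ A B : Type*) [Fintype A] [Fintype B] [DecidableEq B] (ℓ M : ℕ) where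
  law : PMF Λ
  code : Λ → Code A B ℓ M

/-- The error probability of a random code with respect to a jammer state on `J^ℓ`: the
expectation of the error probabilities of its members. -/
def RandomCode.errorProb {Λ : Type*} [Fintype Λ] (N : Channel (A × J) B) {ℓ M : ℕ}
    (R : RandomCode Λ A B ℓ M) (σ : State (Pow J ℓ)) : ℝ :=
  ∑ l, (R.law l).toReal * QAVC.errorProb N (R.code l) σ

end

/-- The permutation operator `U^π` on `X^ℓ`, which maps the basis vector `x` to `x ∘ π⁻¹`. -/
def permOp (X : Type*) [DecidableEq X] {ℓ : ℕ} (π : Equiv.Perm (Fin ℓ)) : Op (Pow X ℓ) :=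
  Matrix.of fun y x => if y = x ∘ ⇑π⁻¹ then 1 else 0

/-- `U^π |α_1⟩ ⋯ |α_ℓ⟩ = |α_{π⁻¹(1)}⟩ ⋯ |α_{π⁻¹(ℓ)}⟩`. -/
theorem permOp_mulVec {X : Type*} [Fintype X] [DecidableEq X] {ℓ : ℕ}
    (π : Equiv.Perm (Fin ℓ)) (α : Fin ℓ → X → ℂ) :
    permOp X π *ᵥ (fun x => ∏ i, α i (x i)) = fun x => ∏ i, α (π⁻¹ i) (x i) := by
  ext y
  have h : ∀ x : Pow X ℓ, y = x ∘ ⇑π⁻¹ ↔ y ∘ ⇑π = x := fun x => by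
    constructor <;> rintro rfl <;> ext i <;> simp
  simp only [permOp, Matrix.mulVec, dotProduct, Matrix.of_apply, h, ite_mul, one_mul, zero_mul,
    Finset.sum_ite_eq, Finset.mem_univ, if_true, Function.comp_apply]
  exact Fintype.prod_equiv π _ _ (by simp)

theorem permOp_unitary {X : Type*} [Fintype X] [DecidableEq X] {ℓ : ℕ}
    (π : Equiv.Perm (Fin ℓ)) :
    (permOp X π)ᴴ * permOp X π = 1 ∧ permOp X π * (permOp X π)ᴴ = 1 := by
  have h1 : (permOp X π)ᴴ * permOp X π = 1 := by
    ext x x'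
    have h : x' ∘ ⇑π⁻¹ = x ∘ ⇑π⁻¹ ↔ x = x' :=
      (π⁻¹).surjective.injective_comp_right.eq_iff.trans eq_comm
    simp [permOp, Matrix.mul_apply, Matrix.conjTranspose_apply, Matrix.one_apply, apply_ite,
      -Equiv.Perm.coe_inv]
    split_ifs with hx
    · exact h.mpr hx
    · exact fun hh => hx (h.mp hh)
  exact ⟨h1, mul_eq_one_comm.mp h1⟩

/-- `U^π ρ U^{π†}` for a state `ρ`. -/
def State.permute {X : Type*} [Fintype X] [DecidableEq X] {ℓ : ℕ} (π : Equiv.Perm (Fin ℓ))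
    (ρ : State (Pow X ℓ)) : State (Pow X ℓ) where
  op := permOp X π * ρ.op * (permOp X π)ᴴ
  posSemidef := ρ.posSemidef.mul_mul_conjTranspose_same _
  trace_eq_one := by
    rw [Matrix.trace_mul_comm, ← mul_assoc, (permOp_unitary π).1, one_mul, ρ.trace_eq_one]

/-- The permuted code `𝒞_π`. -/
def Code.permute {A B : Type*} [Fintype A] [Fintype B] [DecidableEq A] [DecidableEq B]
    {ℓ M : ℕ} (C : Code A B ℓ M) (π : Equiv.Perm (Fin ℓ)) : Code A B ℓ M where
  enc m := (C.enc m).permute π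
  dec m := permOp B π * C.dec m * (permOp B π)ᴴ
  dec_posSemidef m := (C.dec_posSemidef m).mul_mul_conjTranspose_same _
  dec_sum := by
    rw [← Finset.sum_mul, ← Finset.mul_sum, C.dec_sum, mul_one, (permOp_unitary π).2]

/-- The random code `(𝒞_π)` with a uniformly distributed permutation `π` of `[ℓ]`. -/
def Code.randomPermute {A B : Type*} [Fintype A] [Fintype B] [DecidableEq A] [DecidableEq B]
    {ℓ M : ℕ} (C : Code A B ℓ M) : RandomCode (Equiv.Perm (Fin ℓ)) A B ℓ M where
  law := PMF.uniformOfFintype (Equiv.Perm (Fin ℓ))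
  code π := C.permute π

end

end QAVC

/-!
By Wick's formula, the Gaussian average of `|v^{⊗ℓ}⟩⟨v^{⊗ℓ}|` is the sum `S` of all permutation
operators, that is, `ℓ!` times the projection onto the symmetric subspace, so that
`ℓ! |ψ⟩⟨ψ| ≤ ‖ψ‖² S` for every symmetric `ψ`. The square root of a permutation invariant state `ζ`
of `J^ℓ` is a symmetric vector in `(J ⊗ J)^ℓ` purifying `ζ`, and tracing out the second factor
bounds `ζ` by a Gaussian mixture of unnormalized i.i.d. states. The total weight of the mixture is
the dimension of the symmetric subspace of `(J ⊗ J)^ℓ`, which is at most `(ℓ + 1) ^ |J|²`.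
Permuting the code amounts to permuting the jammer's systems, so the expected error probability is
the value at the twirled, hence permutation invariant, jammer state of a positive linear functional
bounded by `ε` on i.i.d. states.
-/

namespace QAVC

open MeasureTheory Finset
open scoped Nat ComplexConjugate MatrixOrder

noncomputable section
section Gaussian

/-- The standard complex Gaussian distribution, normalized so that `|z|²` has mean `1`. -/
def complexGaussian : Measure ℂ :=
  volume.withDensity fun z => ENNReal.ofReal (Real.pi⁻¹ * Real.exp (-‖z‖ ^ 2))

theorem measurable_complexGaussian_density :
    Measurable fun z : ℂ => ENNReal.ofReal (Real.pi⁻¹ * Real.exp (-‖z‖ ^ 2)) := by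
  fun_prop

theorem complexGaussian_density_toReal (z : ℂ) :
    (ENNReal.ofReal (Real.pi⁻¹ * Real.exp (-‖z‖ ^ 2))).toReal =
      Real.pi⁻¹ * Real.exp (-‖z‖ ^ 2) :=
  ENNReal.toReal_ofReal (by positivity)

theorem integral_complexGaussian {E : Type*} [NormedAddCommGroup E] [NormedSpace ℝ E]
    (f : ℂ → E) :
    ∫ z, f z ∂complexGaussian = ∫ z, (Real.pi⁻¹ * Real.exp (-‖z‖ ^ 2)) • f z := by
  rw [complexGaussian, integral_withDensity_eq_integral_toReal_smul
    measurable_complexGaussian_density (.of_forall fun _ => ENNReal.ofReal_lt_top)]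
  simp only [complexGaussian_density_toReal]

theorem integral_norm_pow_complexGaussian (n : ℕ) :
    ∫ z, ‖z‖ ^ n ∂complexGaussian = Real.Gamma (n / 2 + 1) := by
  have h := Complex.integral_rpow_mul_exp_neg_rpow (p := 2) (q := n) (by norm_num)
    (by linarith [n.cast_nonneg (α := ℝ)])
  simp only [Real.rpow_natCast, Real.rpow_ofNat] at h
  rw [integral_complexGaussian]
  simp_rw [smul_eq_mul, mul_assoc, mul_comm (Real.exp _)]
  rw [integral_const_mul, h, add_div]
  field_simp

instance : IsProbabilityMeasure complexGaussian := by
  rw [isProbabilityMeasure_iff_real]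
  simpa using integral_norm_pow_complexGaussian 0

theorem integrable_pow_mul_conj_pow (s t : ℕ) :
    Integrable (fun z => z ^ s * conj z ^ t) complexGaussian := by
  have hnorm : Integrable (fun z => ‖z‖ ^ (s + t)) complexGaussian := by
    refine .of_integral_ne_zero ?_
    rw [integral_norm_pow_complexGaussian]
    exact (Real.Gamma_pos_of_pos (by positivity)).ne'
  refine hnorm.mono' (by fun_prop) (.of_forall fun z => ?_)
  rw [norm_mul, norm_pow, norm_pow, RCLike.norm_conj, pow_add]

theorem integral_complexGaussian_comp_rotation {E : Type*} [NormedAddCommGroup E] [NormedSpace ℝ E]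
    (c : Circle) (f : ℂ → E) :
    ∫ z, f (c * z) ∂complexGaussian = ∫ z, f z ∂complexGaussian := by
  simp only [integral_complexGaussian]
  rw [← (rotation c).measurePreserving.integral_comp
    (rotation c).toHomeomorph.measurableEmbedding
    fun z => (Real.pi⁻¹ * Real.exp (-‖z‖ ^ 2)) • f z]
  simp only [rotation_apply, norm_mul, Circle.norm_coe, one_mul]

theorem exists_circle_pow_mul_conj_pow_ne_one {s t : ℕ} (h : s ≠ t) :
    ∃ c : Circle, (c : ℂ) ^ s * conj (c : ℂ) ^ t ≠ 1 := by
  have hst : (s : ℂ) - t ≠ 0 := sub_ne_zero.mpr (Nat.cast_injective.ne h)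
  refine ⟨Circle.exp (Real.pi / ((s : ℝ) - t)), ?_⟩
  have hexp : (Circle.exp (Real.pi / ((s : ℝ) - t)) : ℂ) ^ s *
      conj (Circle.exp (Real.pi / ((s : ℝ) - t)) : ℂ) ^ t = -1 := by
    rw [Circle.coe_exp, ← Complex.exp_conj, ← Complex.exp_nat_mul, ← Complex.exp_nat_mul,
      ← Complex.exp_add, ← Complex.exp_pi_mul_I]
    congr 1
    simp only [map_mul, Complex.conj_ofReal, Complex.conj_I]
    push_cast
    field_simp
    ring
  rw [hexp]
  norm_num

theorem integral_pow_mul_conj_pow_self (s : ℕ) :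
    ∫ z, z ^ s * conj z ^ s ∂complexGaussian = s ! := by
  simp_rw [← mul_pow, Complex.mul_conj', ← pow_mul, ← Complex.ofReal_pow]
  rw [integral_complex_ofReal, integral_norm_pow_complexGaussian]
  push_cast
  rw [mul_div_cancel_left₀ _ two_ne_zero, Real.Gamma_nat_eq_factorial, Complex.ofReal_natCast]

theorem integral_pow_mul_conj_pow_of_ne {s t : ℕ} (h : s ≠ t) :
    ∫ z, z ^ s * conj z ^ t ∂complexGaussian = 0 := by
  obtain ⟨c, hc⟩ := exists_circle_pow_mul_conj_pow_ne_one h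
  have hrot : (c : ℂ) ^ s * conj (c : ℂ) ^ t * ∫ z, z ^ s * conj z ^ t ∂complexGaussian =
      ∫ z, z ^ s * conj z ^ t ∂complexGaussian := by
    rw [← integral_const_mul,
      ← integral_complexGaussian_comp_rotation c fun z => z ^ s * conj z ^ t]
    refine integral_congr_ae (.of_forall fun z => ?_)
    simp only [map_mul, mul_pow]
    ring
  exact by_contra fun h0 => hc ((mul_eq_right₀ h0).mp hrot)

theorem integral_pow_mul_conj_pow (s t : ℕ) :
    ∫ z, z ^ s * conj z ^ t ∂complexGaussian = if s = t then (s ! : ℂ) else 0 := by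
  split_ifs with h
  · rw [← h, integral_pow_mul_conj_pow_self]
  · exact integral_pow_mul_conj_pow_of_ne h

end Gaussian

section Words

variable {ι K : Type*} [Fintype ι] [DecidableEq K]

/-- The type of a word: the number of occurrences of each letter. -/
def occ (x : ι → K) (k : K) : ℕ := #{i | x i = k}

theorem occ_comp_perm (x : ι → K) (π : Equiv.Perm ι) : occ (x ∘ π) = occ x := by
  ext k
  exact card_equiv π (by simp)

theorem exists_perm_of_occ_eq {x y : ι → K} (h : occ x = occ y) :
    ∃ π : Equiv.Perm ι, x ∘ π = y := by
  have e (k : K) : Nonempty ({i // y i = k} ≃ {i // x i = k}) :=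
    ⟨Fintype.equivOfCardEq (by simpa [Fintype.card_subtype, occ] using (congrFun h k).symm)⟩
  refine ⟨(Equiv.sigmaFiberEquiv y).symm.trans
    ((Equiv.sigmaCongrRight fun k => (e k).some).trans (Equiv.sigmaFiberEquiv x)), ?_⟩
  ext i
  exact ((e (y i)).some ⟨i, rfl⟩).2

variable [DecidableEq ι] [Fintype K]

theorem card_perm_comp_eq_self (x : ι → K) :
    #{π : Equiv.Perm ι | x ∘ π = x} = ∏ k, (occ x k)! := by
  simpa only [Fintype.card_subtype, occ] using DomMulAct.stabilizer_card x

theorem card_perm_comp_eq (x y : ι → K) :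
    #{π : Equiv.Perm ι | x ∘ π = y} = if occ x = occ y then ∏ k, (occ x k)! else 0 := by
  split_ifs with h
  · obtain ⟨σ, rfl⟩ := exists_perm_of_occ_eq h
    rw [← card_perm_comp_eq_self]
    refine card_equiv (Equiv.mulRight σ⁻¹) fun π => ?_
    simp only [mem_filter_univ, Equiv.coe_mulRight, Equiv.Perm.coe_mul, ← Function.comp_assoc]
    exact σ.symm.eq_comp_symm _ _
  · rw [card_eq_zero, filter_eq_empty_iff]
    rintro π - rfl
    exact h (occ_comp_perm x π).symm

theorem sum_card_perm_comp_eq_self :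
    ∑ x : ι → K, #{π : Equiv.Perm ι | x ∘ π = x} =
      (Fintype.card ι)! * #(univ.image (occ : (ι → K) → K → ℕ)) := by
  have hfiber : ∀ t ∈ univ.image (occ : (ι → K) → K → ℕ),
      ∑ x with occ x = t, #{π : Equiv.Perm ι | x ∘ π = x} = (Fintype.card ι)! := by
    intro t ht
    obtain ⟨x₀, -, rfl⟩ := mem_image.mp ht
    calc ∑ x with occ x = occ x₀, #{π : Equiv.Perm ι | x ∘ π = x}
        = ∑ x, #{π : Equiv.Perm ι | x₀ ∘ π = x} := by
          rw [sum_filter]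
          refine sum_congr rfl fun x _ => ?_
          simp only [card_perm_comp_eq, eq_comm (a := occ x₀)]
          split_ifs with h <;> simp [h]
      _ = (Fintype.card ι)! := by
          rw [← card_eq_sum_card_fiberwise fun _ _ => mem_coe.mpr (mem_univ _), card_univ,
            Fintype.card_perm]
  rw [← sum_fiberwise_of_maps_to (g := occ) fun x _ => mem_image_of_mem occ (mem_univ x),
    sum_congr rfl hfiber, sum_const, smul_eq_mul, mul_comm]

theorem card_image_occ_le :
    #(univ.image (occ : (ι → K) → K → ℕ)) ≤ (Fintype.card ι + 1) ^ Fintype.card K := by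
  calc #(univ.image (occ : (ι → K) → K → ℕ))
      ≤ #(Fintype.piFinset fun _ : K => range (Fintype.card ι + 1)) := by
        refine card_le_card (image_subset_iff.mpr fun x _ => Fintype.mem_piFinset.mpr fun k => ?_)
        exact mem_range_succ_iff.mpr (card_le_univ _)
    _ = (Fintype.card ι + 1) ^ Fintype.card K := by simp [Fintype.card_piFinset]

end Words

section Wick

variable {ι K : Type*} [Fintype ι] [Fintype K]

/-- The standard Gaussian distribution on `ℂ^K`. -/
def gaussianVec (K : Type*) [Fintype K] : Measure (K → ℂ) :=
  Measure.pi fun _ => complexGaussian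

/-- The coordinates of the tensor power `v^{⊗ι}`. -/
def vecPow (v : K → ℂ) (x : ι → K) : ℂ := ∏ i, v (x i)

variable [DecidableEq K]

theorem vecPow_eq_prod_pow_occ (v : K → ℂ) (x : ι → K) : vecPow v x = ∏ k, v k ^ occ x k := by
  rw [vecPow, ← prod_fiberwise' univ x v]
  simp only [prod_const, occ]

theorem vecPow_mul_conj_vecPow (v : K → ℂ) (x y : ι → K) :
    vecPow v x * conj (vecPow v y) = ∏ k, v k ^ occ x k * conj (v k) ^ occ y k := by
  simp only [vecPow_eq_prod_pow_occ, map_prod, map_pow, prod_mul_distrib]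

omit [DecidableEq K] in
theorem integrable_vecPow_mul_conj_vecPow (x y : ι → K) :
    Integrable (fun v => vecPow v x * conj (vecPow v y)) (gaussianVec K) := by
  classical
  simp only [vecPow_mul_conj_vecPow]
  exact .fintype_prod fun k => integrable_pow_mul_conj_pow (occ x k) (occ y k)

theorem integral_vecPow_mul_conj_vecPow [DecidableEq ι] (x y : ι → K) :
    ∫ v, vecPow v x * conj (vecPow v y) ∂gaussianVec K = #{π : Equiv.Perm ι | x ∘ π = y} := by
  simp only [vecPow_mul_conj_vecPow, gaussianVec]
  rw [integral_fintype_prod_eq_prod fun k z => z ^ occ x k * conj z ^ occ y k,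
    card_perm_comp_eq]
  simp_rw [integral_pow_mul_conj_pow]
  split_ifs with h
  · simp [h]
  · obtain ⟨k, hk⟩ := Function.ne_iff.mp h
    rw [prod_eq_zero (mem_univ k) (if_neg hk), Nat.cast_zero]

end Wick

section Permutations

variable {X : Type*} [DecidableEq X] {ℓ : ℕ}

theorem permOp_apply (π : Equiv.Perm (Fin ℓ)) (y x : Pow X ℓ) :
    permOp X π y x = if y ∘ π = x then 1 else 0 := by
  have h : y = x ∘ ⇑π⁻¹ ↔ y ∘ π = x := π.eq_comp_symm y x
  simp only [permOp, Matrix.of_apply, h]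

theorem permOp_conjTranspose (π : Equiv.Perm (Fin ℓ)) : (permOp X π)ᴴ = permOp X π⁻¹ := by
  ext y x
  rw [Matrix.conjTranspose_apply, permOp_apply π⁻¹]
  simp only [permOp, Matrix.of_apply, eq_comm (a := x), apply_ite star, star_one, star_zero]

variable [Fintype X]

theorem permOp_mulVec_apply (π : Equiv.Perm (Fin ℓ)) (ψ : Pow X ℓ → ℂ) (x : Pow X ℓ) :
    (permOp X π *ᵥ ψ) x = ψ (x ∘ π) := by
  simp [Matrix.mulVec, dotProduct, permOp_apply]

theorem permOp_mul_apply (π : Equiv.Perm (Fin ℓ)) (P : Op (Pow X ℓ)) (x y : Pow X ℓ) :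
    (permOp X π * P) x y = P (x ∘ π) y := by
  simp [Matrix.mul_apply, permOp_apply]

theorem mul_permOp_conjTranspose_apply (π : Equiv.Perm (Fin ℓ)) (P : Op (Pow X ℓ))
    (x y : Pow X ℓ) : (P * (permOp X π)ᴴ) x y = P x (y ∘ π) := by
  simp [Matrix.mul_apply, permOp_apply, apply_ite]

theorem permOp_conj_apply (π : Equiv.Perm (Fin ℓ)) (P : Op (Pow X ℓ)) (x y : Pow X ℓ) :
    (permOp X π * P * (permOp X π)ᴴ) x y = P (x ∘ π) (y ∘ π) := by
  rw [mul_permOp_conjTranspose_apply, permOp_mul_apply]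

theorem permOp_mul_permOp (π σ : Equiv.Perm (Fin ℓ)) :
    permOp X π * permOp X σ = permOp X (π * σ) := by
  ext x y
  rw [permOp_mul_apply, permOp_apply, permOp_apply, Function.comp_assoc, Equiv.Perm.coe_mul]

/-- Operators on `X^ℓ` which are invariant under permutations of the tensor factors. -/
def IsPermInvariant (P : Op (Pow X ℓ)) : Prop :=
  ∀ π : Equiv.Perm (Fin ℓ), permOp X π * P * (permOp X π)ᴴ = P

/-- Vectors in the symmetric subspace of `X^ℓ`. -/
def IsSymmetric (ψ : Pow X ℓ → ℂ) : Prop :=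
  ∀ π : Equiv.Perm (Fin ℓ), permOp X π *ᵥ ψ = ψ

end Permutations

section SymmetricSubspace

theorem posSemidef_of_mul_self_eq_smul {Y : Type*} [Fintype Y] {Q : Op Y} {c : ℂ}
    (hQ : Q.IsHermitian) (hc : 0 < c) (h : Q * Q = c • Q) : Q.PosSemidef := by
  have hsq : (c • Q).PosSemidef := by
    rw [← h]
    nth_rewrite 1 [← hQ]
    exact Matrix.posSemidef_conjTranspose_mul_self Q
  simpa only [smul_smul, inv_mul_cancel₀ hc.ne', one_smul] using hsq.smul (inv_nonneg.mpr hc.le)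

variable {X : Type*} [DecidableEq X] {ℓ : ℕ}

variable (X ℓ) in
/-- The sum of all permutation operators, that is, `ℓ!` times the orthogonal projection onto the
symmetric subspace of `X^ℓ`. -/
def permSum : Op (Pow X ℓ) := ∑ π : Equiv.Perm (Fin ℓ), permOp X π

theorem permSum_apply (x y : Pow X ℓ) :
    permSum X ℓ x y = #{π : Equiv.Perm (Fin ℓ) | x ∘ π = y} := by
  simp only [permSum, Matrix.sum_apply, permOp_apply, sum_boole]

theorem permSum_isHermitian : (permSum X ℓ).IsHermitian := by
  rw [Matrix.IsHermitian, permSum, Matrix.conjTranspose_sum]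
  simp only [permOp_conjTranspose]
  exact Equiv.sum_comp (Equiv.inv _) (permOp X)

variable [Fintype X]

theorem permOp_mul_permSum (π : Equiv.Perm (Fin ℓ)) :
    permOp X π * permSum X ℓ = permSum X ℓ := by
  simp only [permSum, mul_sum, permOp_mul_permOp]
  exact Equiv.sum_comp (Equiv.mulLeft π) (permOp X)

theorem permSum_mul_self : permSum X ℓ * permSum X ℓ = (ℓ ! : ℂ) • permSum X ℓ := by
  conv_lhs => rw [permSum, sum_mul, ← permSum]
  simp only [permOp_mul_permSum, sum_const, card_univ, Fintype.card_perm, Fintype.card_fin,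
    Nat.cast_smul_eq_nsmul]

theorem trace_permSum :
    (permSum X ℓ).trace = ℓ ! * #(univ.image (occ : Pow X ℓ → X → ℕ)) := by
  simp only [Matrix.trace, Matrix.diag_apply, permSum_apply]
  exact_mod_cast (sum_card_perm_comp_eq_self (ι := Fin ℓ) (K := X)).trans (by simp)

theorem IsSymmetric.permSum_mulVec {ψ : Pow X ℓ → ℂ} (hψ : IsSymmetric ψ) :
    permSum X ℓ *ᵥ ψ = (ℓ ! : ℂ) • ψ := by
  simp only [permSum, Matrix.sum_mulVec, hψ _, sum_const, card_univ, Fintype.card_perm,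
    Fintype.card_fin, Nat.cast_smul_eq_nsmul]

theorem IsSymmetric.factorial_smul_vecMulVec_le {ψ : Pow X ℓ → ℂ} (hψ : IsSymmetric ψ) :
    (ℓ ! : ℂ) • Matrix.vecMulVec ψ (star ψ) ≤ (ψ ⬝ᵥ star ψ) • permSum X ℓ := by
  rcases eq_or_ne ψ 0 with rfl | h0
  · simp
  set S := permSum X ℓ
  set R := Matrix.vecMulVec ψ (star ψ)
  set a := ψ ⬝ᵥ star ψ
  have hS : S.IsHermitian := permSum_isHermitian
  have hR : R.IsHermitian := (Matrix.posSemidef_vecMulVec_self_star ψ).isHermitian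
  have ha : 0 < a :=
    (dotProduct_self_star_nonneg ψ).lt_of_ne' (dotProduct_self_star_eq_zero.not.mpr h0)
  have hSS : S * S = (ℓ ! : ℂ) • S := permSum_mul_self
  have hSR : S * R = (ℓ ! : ℂ) • R := by
    rw [Matrix.mul_vecMulVec, hψ.permSum_mulVec, Matrix.smul_vecMulVec]
  have hRS : R * S = (ℓ ! : ℂ) • R := by
    rw [← hR.eq, ← hS.eq, ← Matrix.conjTranspose_mul, hSR]
    simp
  have hRR : R * R = a • R := by
    rw [Matrix.vecMulVec_mul_vecMulVec, dotProduct_comm, Matrix.vecMulVec_smul]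
  rw [Matrix.le_iff]
  refine posSemidef_of_mul_self_eq_smul (c := a * ℓ !) ?_
    (mul_pos ha (by exact_mod_cast ℓ.factorial_pos)) ?_
  · rw [Matrix.IsHermitian, Matrix.conjTranspose_sub, Matrix.conjTranspose_smul,
      Matrix.conjTranspose_smul, hS, hR, ha.le.star_eq, star_natCast]
  · simp only [sub_mul, mul_sub, smul_mul_smul_comm, hSS, hSR, hRS, hRR, smul_smul,
      smul_sub]
    module

end SymmetricSubspace

section PartialTrace

variable {J K : Type*} [Fintype K] {ℓ : ℕ}

/-- The partial trace over `K^ℓ` of operators on `(J ⊗ K)^ℓ`. -/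
def traceRight : Op (Pow (J × K) ℓ) →ₗ[ℂ] Op (Pow J ℓ) where
  toFun P := ∑ z : Pow K ℓ, P.submatrix (fun x i => (x i, z i)) fun x i => (x i, z i)
  map_add' P Q := by
    simp only [Matrix.submatrix_add, Pi.add_apply, sum_add_distrib]
  map_smul' c P := by
    simp only [Matrix.submatrix_smul, Pi.smul_apply, smul_sum, RingHom.id_apply]

theorem traceRight_apply (P : Op (Pow (J × K) ℓ)) :
    traceRight P = ∑ z : Pow K ℓ, P.submatrix (fun x i => (x i, z i)) fun x i => (x i, z i) :=
  rfl

theorem traceRight_posSemidef {P : Op (Pow (J × K) ℓ)} (hP : P.PosSemidef) :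
    (traceRight P).PosSemidef :=
  Matrix.posSemidef_sum _ fun _ _ => hP.submatrix _

theorem trace_traceRight [Fintype J] (P : Op (Pow (J × K) ℓ)) : (traceRight P).trace = P.trace := by
  rw [traceRight_apply, Matrix.trace_sum]
  simp only [Matrix.trace, Matrix.diag_apply, Matrix.submatrix_apply]
  rw [sum_comm, ← Fintype.sum_prod_type',
    ← (Equiv.arrowProdEquivProdArrow (Fin ℓ) (fun _ => J) (fun _ => K)).sum_comp]
  rfl

/-- An operator `V : K^ℓ → J^ℓ` as a vector of `(J ⊗ K)^ℓ`, a purification of `V * Vᴴ`. -/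
def purification (V : Matrix (Pow J ℓ) (Pow K ℓ) ℂ) (u : Pow (J × K) ℓ) : ℂ :=
  V (Prod.fst ∘ u) (Prod.snd ∘ u)

theorem traceRight_vecMulVec_purification (V : Matrix (Pow J ℓ) (Pow K ℓ) ℂ) :
    traceRight (Matrix.vecMulVec (purification V) (star (purification V))) = V * Vᴴ := by
  ext x y
  rw [traceRight_apply, Matrix.sum_apply, Matrix.mul_apply]
  rfl

theorem purification_dotProduct_star [Fintype J] (V : Matrix (Pow J ℓ) (Pow K ℓ) ℂ) :
    purification V ⬝ᵥ star (purification V) = (V * Vᴴ).trace := by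
  rw [← Matrix.trace_vecMulVec, ← trace_traceRight, traceRight_vecMulVec_purification]

theorem traceRight_vecMulVec_vecPow (v : J × K → ℂ) :
    traceRight (Matrix.vecMulVec (vecPow v) (star (vecPow v))) =
      tensorOp fun _ : Fin ℓ => Matrix.of (Function.curry v) * (Matrix.of (Function.curry v))ᴴ := by
  classical
  have hvec : vecPow (ι := Fin ℓ) v =
      purification (Matrix.of fun x z => ∏ i, v (x i, z i)) := rfl
  rw [hvec, traceRight_vecMulVec_purification]
  ext x y
  simp only [tensorOp, Matrix.mul_apply, Matrix.conjTranspose_apply, Matrix.of_apply, star_prod,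
    ← prod_mul_distrib, Function.curry_apply]
  rw [prod_univ_sum, Fintype.piFinset_univ]

end PartialTrace

section DeFinetti

variable {J : Type*} [Fintype J] [DecidableEq J] {ℓ : ℕ}

theorem permOp_conj_eq_iff_commute (π : Equiv.Perm (Fin ℓ)) (P : Op (Pow J ℓ)) :
    permOp J π * P * (permOp J π)ᴴ = P ↔ Commute P (permOp J π) := by
  obtain ⟨hleft, hright⟩ := permOp_unitary (X := J) π
  rw [Commute, SemiconjBy]
  constructor
  · intro h
    conv_lhs => rw [← h, mul_assoc, hleft, mul_one]
  · intro h
    rw [← h, mul_assoc, hright, mul_one]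

theorem IsPermInvariant.sqrt {P : Op (Pow J ℓ)} (hP : IsPermInvariant P) :
    IsPermInvariant (CFC.sqrt P) := fun π =>
  (permOp_conj_eq_iff_commute π _).mpr
    (((permOp_conj_eq_iff_commute π P).mp (hP π)).cfcₙ_nnreal _)

theorem IsPermInvariant.isSymmetric_purification {V : Op (Pow J ℓ)} (hV : IsPermInvariant V) :
    IsSymmetric (purification V) := fun π => by
  ext u
  rw [permOp_mulVec_apply, purification, purification]
  conv_rhs => rw [← hV π, permOp_conj_apply]
  rfl

theorem IsPermInvariant.factorial_smul_le {P : Op (Pow J ℓ)} (hP : IsPermInvariant P)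
    (hpos : P.PosSemidef) :
    (ℓ ! : ℂ) • P ≤ P.trace • traceRight (permSum (J × J) ℓ) := by
  have hsqrt : CFC.sqrt P * (CFC.sqrt P)ᴴ = P := by
    rw [(Matrix.nonneg_iff_posSemidef.mp (CFC.sqrt_nonneg P)).isHermitian.eq,
      CFC.sqrt_mul_sqrt_self P hpos.nonneg]
  have hψ := hP.sqrt.isSymmetric_purification.factorial_smul_vecMulVec_le
  rw [purification_dotProduct_star, hsqrt] at hψ
  have htr := traceRight_posSemidef (Matrix.le_iff.mp hψ)
  rwa [map_sub, map_smul, map_smul, traceRight_vecMulVec_purification, hsqrt] at htr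

end DeFinetti

section Functionals

variable {X : Type*}

theorem functional_apply_eq_sum [Fintype X] [DecidableEq X] (F : Op X →ₗ[ℂ] ℂ) (P : Op X) :
    F P = ∑ x, ∑ y, P x y * F (Matrix.single x y 1) := by
  conv_lhs => rw [Matrix.matrix_eq_sum_single P]
  simp only [map_sum, ← smul_eq_mul, ← map_smul, Matrix.smul_single]
  simp only [smul_eq_mul, mul_one]

theorem integrable_functional [Finite X] {Ω : Type*} [MeasurableSpace Ω] {μ : Measure Ω}
    {P : Ω → Op X} (F : Op X →ₗ[ℂ] ℂ)
    (hP : ∀ x y, Integrable (fun ω => P ω x y) μ) : Integrable (fun ω => F (P ω)) μ := by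
  classical
  cases nonempty_fintype X
  simp only [functional_apply_eq_sum F (P _)]
  exact integrable_finsetSum _ fun x _ => integrable_finsetSum _ fun y _ => (hP x y).mul_const _

theorem integral_functional [Finite X] {Ω : Type*} [MeasurableSpace Ω] {μ : Measure Ω}
    {P : Ω → Op X} (F : Op X →ₗ[ℂ] ℂ) (hP : ∀ x y, Integrable (fun ω => P ω x y) μ) :
    ∫ ω, F (P ω) ∂μ = F (Matrix.of fun x y => ∫ ω, P ω x y ∂μ) := by
  classical
  cases nonempty_fintype X
  simp only [functional_apply_eq_sum F (P _), functional_apply_eq_sum F (Matrix.of _)]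
  rw [integral_finsetSum _ fun x _ => integrable_finsetSum _ fun y _ => (hP x y).mul_const _]
  refine sum_congr rfl fun x _ => ?_
  rw [integral_finsetSum _ fun y _ => (hP x y).mul_const _]
  exact sum_congr rfl fun y _ => integral_mul_const _ _

theorem integrable_functional_vecMulVec_vecPow [Fintype X] {ℓ : ℕ} (F : Op (Pow X ℓ) →ₗ[ℂ] ℂ) :
    Integrable (fun v => F (Matrix.vecMulVec (vecPow v) (star (vecPow v)))) (gaussianVec X) := by
  exact integrable_functional F integrable_vecPow_mul_conj_vecPow

theorem integral_functional_vecMulVec_vecPow [Fintype X] [DecidableEq X] {ℓ : ℕ}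
    (F : Op (Pow X ℓ) →ₗ[ℂ] ℂ) :
    ∫ v, F (Matrix.vecMulVec (vecPow v) (star (vecPow v))) ∂gaussianVec X = F (permSum X ℓ) := by
  refine (integral_functional (P := fun v => Matrix.vecMulVec (vecPow v) (star (vecPow v))) F
    integrable_vecPow_mul_conj_vecPow).trans ?_
  congr 1
  ext x y
  rw [permSum_apply]
  exact integral_vecPow_mul_conj_vecPow x y

theorem functional_permSum_re_le [Finite X] [DecidableEq X] {ℓ : ℕ} {F G : Op (Pow X ℓ) →ₗ[ℂ] ℂ}
    (hFG : ∀ v : X → ℂ, (F (Matrix.vecMulVec (vecPow v) (star (vecPow v)))).re ≤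
      (G (Matrix.vecMulVec (vecPow v) (star (vecPow v)))).re) :
    (F (permSum X ℓ)).re ≤ (G (permSum X ℓ)).re := by
  cases nonempty_fintype X
  have hF := integrable_functional_vecMulVec_vecPow F
  have hG := integrable_functional_vecMulVec_vecPow G
  rw [← integral_functional_vecMulVec_vecPow F, ← integral_functional_vecMulVec_vecPow G]
  exact (integral_re hF).symm.trans_le ((integral_mono hF.re hG.re hFG).trans_eq (integral_re hG))

end Functionals

section PostSelection

variable {J : Type*} [Fintype J] {ℓ : ℕ}

instance State.instNonempty [Nonempty J] : Nonempty (State J) := by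
  classical
  obtain ⟨j⟩ := ‹Nonempty J›
  exact ⟨⟨Matrix.diagonal (Pi.single j 1),
    Matrix.posSemidef_diagonal_iff.mpr (Pi.single_nonneg.mpr zero_le_one : (0 : J → ℂ) ≤ _),
    by simp [Matrix.trace_diagonal]⟩⟩

theorem exists_state_eq_trace_smul [Nonempty J] {P : Op J} (hP : P.PosSemidef) :
    ∃ σ : State J, P = P.trace • σ.op := by
  by_cases htr : P.trace = 0
  · exact ⟨Classical.arbitrary _, by rw [hP.trace_eq_zero_iff.mp htr, Matrix.trace_zero, zero_smul]⟩
  · refine ⟨⟨P.trace⁻¹ • P, hP.smul (inv_nonneg.mpr hP.trace_nonneg), ?_⟩, ?_⟩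
    · rw [Matrix.trace_smul, smul_eq_mul, inv_mul_cancel₀ htr]
    · rw [smul_smul, mul_inv_cancel₀ htr, one_smul]

omit [Fintype J] in
theorem tensorOp_smul (c : ℂ) (P : Op J) :
    tensorOp (fun _ : Fin ℓ => c • P) = c ^ ℓ • tensorOp fun _ : Fin ℓ => P := by
  ext x y
  simp [tensorOp, prod_mul_distrib]

theorem functional_tensorOp_le [Nonempty J] {F : Op (Pow J ℓ) →ₗ[ℂ] ℂ} {ε : ℝ}
    (hF : ∀ σ : State J, (F (σ.pow ℓ).op).re ≤ ε) {P : Op J} (hP : P.PosSemidef) :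
    (F (tensorOp fun _ => P)).re ≤ ε * (tensorOp fun _ : Fin ℓ => P).trace.re := by
  obtain ⟨σ, hσ⟩ := exists_state_eq_trace_smul hP
  obtain ⟨c, hc, hcP⟩ := RCLike.nonneg_iff_exists_ofReal.mp hP.trace_nonneg
  have hpow : tensorOp (fun _ : Fin ℓ => P) = ((c ^ ℓ : ℝ) : ℂ) • (σ.pow ℓ).op := by
    rw [hσ, ← hcP, tensorOp_smul, Complex.ofReal_pow]
    rfl
  rw [hpow, map_smul, Matrix.trace_smul, (σ.pow ℓ).trace_eq_one, smul_eq_mul, smul_eq_mul,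
    Complex.re_ofReal_mul, Complex.re_ofReal_mul, Complex.one_re, mul_one, mul_comm]
  exact mul_le_mul_of_nonneg_right (hF σ) (pow_nonneg hc ℓ)

theorem functional_traceRight_permSum_le [DecidableEq J] [Nonempty J] {F : Op (Pow J ℓ) →ₗ[ℂ] ℂ}
    {ε : ℝ} (hF : ∀ σ : State J, (F (σ.pow ℓ).op).re ≤ ε) :
    (F (traceRight (permSum (J × J) ℓ))).re ≤ ε * (permSum (J × J) ℓ).trace.re := by
  have hle := functional_permSum_re_le (F := F.comp traceRight)
    (G := (ε : ℂ) • Matrix.traceLinearMap (Pow (J × J) ℓ) ℂ ℂ) fun v => by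
      simp only [LinearMap.comp_apply, LinearMap.smul_apply, Matrix.traceLinearMap_apply,
        smul_eq_mul, Complex.re_ofReal_mul]
      rw [← trace_traceRight, traceRight_vecMulVec_vecPow]
      exact functional_tensorOp_le hF (Matrix.posSemidef_self_mul_conjTranspose _)
  simpa only [LinearMap.comp_apply, LinearMap.smul_apply, Matrix.traceLinearMap_apply,
    smul_eq_mul, Complex.re_ofReal_mul] using hle

theorem IsPermInvariant.functional_le [DecidableEq J] [Nonempty J] {F : Op (Pow J ℓ) →ₚ[ℂ] ℂ}
    {ε : ℝ} (hF : ∀ σ : State J, (F (σ.pow ℓ).op).re ≤ ε) {ζ : State (Pow J ℓ)}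
    (hζ : IsPermInvariant ζ.op) :
    (F ζ.op).re ≤ ε * #(univ.image (occ : Pow (J × J) ℓ → J × J → ℕ)) := by
  have hle := hζ.factorial_smul_le ζ.posSemidef
  rw [ζ.trace_eq_one, one_smul] at hle
  have hmul : (ℓ ! : ℝ) * (F ζ.op).re ≤
      ℓ ! * (ε * #(univ.image (occ : Pow (J × J) ℓ → J × J → ℕ))) :=
    calc (ℓ ! : ℝ) * (F ζ.op).re = (F ((ℓ ! : ℂ) • ζ.op)).re := by
          rw [map_smul, smul_eq_mul, ← Complex.ofReal_natCast, Complex.re_ofReal_mul]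
      _ ≤ (F (traceRight (permSum (J × J) ℓ))).re :=
          (Complex.le_def.mp (OrderHomClass.mono F hle)).1
      _ ≤ ε * (permSum (J × J) ℓ).trace.re :=
          functional_traceRight_permSum_le (F := F.toLinearMap) hF
      _ = ℓ ! * (ε * #(univ.image (occ : Pow (J × J) ℓ → J × J → ℕ))) := by
          rw [trace_permSum]
          norm_cast
          push_cast
          ring
  exact le_of_mul_le_mul_left hmul (by positivity)

end PostSelection

section CompletePositivity

variable {X Y : Type*}

/-- The Choi matrix of a linear map, which is positive semidefinite when the map is completely
positive. -/
def choi [DecidableEq X] (T : Op X →ₗ[ℂ] Op Y) : Op (X × Y) :=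
  Matrix.of fun p q => T (Matrix.single p.1 q.1 1) p.2 q.2

theorem choi_posSemidef [Fintype X] [DecidableEq X] [Fintype Y] {T : Op X →ₗ[ℂ] Op Y}
    (hT : IsCompletelyPositive T) : (choi T).PosSemidef := by
  let e := Fintype.equivFin X
  let w : Fin (Fintype.card X) × X → ℂ := fun p => if e p.2 = p.1 then 1 else 0
  have hw : ∀ z z' : X, Matrix.single z z' (1 : ℂ) =
      Matrix.of fun x x' => Matrix.vecMulVec w (star w) (e z, x) (e z', x') := fun z z' => by
    ext x x'
    by_cases h1 : z = x <;> by_cases h2 : z' = x' <;>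
      simp [w, Matrix.vecMulVec_apply, h1, h2, eq_comm]
  have hchoi : choi T = (ampliation T _ (Matrix.vecMulVec w (star w))).submatrix
      (fun p : X × Y => (e p.1, p.2)) fun p : X × Y => (e p.1, p.2) := by
    ext p q
    simp only [choi, ampliation, Matrix.submatrix_apply, Matrix.of_apply, hw]
  rw [hchoi]
  exact (hT _ _ (Matrix.posSemidef_vecMulVec_self_star w)).submatrix _

theorem tensorOp_posSemidef [Finite X] {ℓ : ℕ} {P : Fin ℓ → Op X} (hP : ∀ i, (P i).PosSemidef) :
    (tensorOp P).PosSemidef := by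
  cases nonempty_fintype X
  choose R hR using fun i => exists_eq_conjTranspose_mul_self (hP i)
  rw [funext hR, ← tensorOp_mul, ← tensorOp_conjTranspose]
  exact Matrix.posSemidef_conjTranspose_mul_self _

theorem posSemidef_sum_sum_mul [Fintype X] [Finite Y] {P : Op X} (hP : P.PosSemidef)
    {D : Op (X × Y)} (hD : D.PosSemidef) :
    (Matrix.of fun y y' => ∑ x, ∑ x', P x x' * D (x, y) (x', y') : Op Y).PosSemidef := by
  classical
  cases nonempty_fintype Y
  let W : Matrix (X × Y) Y ℂ := Matrix.of fun p y => if p.2 = y then 1 else 0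
  have hW : (Matrix.of fun y y' => ∑ x, ∑ x', P x x' * D (x, y) (x', y') : Op Y) =
      Wᴴ * (P.submatrix Prod.fst Prod.fst ⊙ D) * W := by
    ext y y'
    rw [Matrix.of_apply, sum_comm]
    simp [W, Matrix.mul_apply, Fintype.sum_prod_type, Matrix.hadamard_apply, apply_ite]
  rw [hW]
  exact ((hP.submatrix _).hadamard hD).conjTranspose_mul_mul_same W

theorem tensorPowMap_posSemidef [Fintype X] [DecidableEq X] [Fintype Y] {T : Op X →ₗ[ℂ] Op Y}
    (hT : IsCompletelyPositive T) {ℓ : ℕ} {P : Op (Pow X ℓ)} (hP : P.PosSemidef) :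
    (tensorPowMap T ℓ P).PosSemidef := by
  have hpos := posSemidef_sum_sum_mul hP
    ((tensorOp_posSemidef fun _ : Fin ℓ => choi_posSemidef hT).submatrix
      fun p : Pow X ℓ × Pow Y ℓ => fun i => (p.1 i, p.2 i))
  simp only [Matrix.submatrix_apply, tensorOp, choi, Matrix.of_apply] at hpos
  simpa only [tensorPowMap, LinearMap.coe_mk, AddHom.coe_mk] using hpos

theorem trace_mul_nonneg [Fintype X] {P Q : Op X} (hP : P.PosSemidef) (hQ : Q.PosSemidef) :
    0 ≤ (P * Q).trace := by
  obtain ⟨R, rfl⟩ := exists_eq_conjTranspose_mul_self hQ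
  rw [← mul_assoc, Matrix.trace_mul_comm, ← mul_assoc]
  exact (hP.mul_mul_conjTranspose_same R).trace_nonneg

end CompletePositivity

section Twirling

variable {X : Type*} [Fintype X] [DecidableEq X] {ℓ : ℕ}

theorem permOp_conj_permOp_inv_conj (π : Equiv.Perm (Fin ℓ)) (P : Op (Pow X ℓ)) :
    permOp X π * (permOp X π⁻¹ * P * (permOp X π⁻¹)ᴴ) * (permOp X π)ᴴ = P := by
  ext x y
  simp only [permOp_conj_apply, Function.comp_assoc, ← Equiv.Perm.coe_mul, mul_inv_cancel,
    Equiv.Perm.coe_one, Function.comp_id]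

theorem trace_permOp_conj_mul_one_sub (π : Equiv.Perm (Fin ℓ)) (P D : Op (Pow X ℓ)) :
    (permOp X π * P * (permOp X π)ᴴ * (1 - permOp X π * D * (permOp X π)ᴴ)).trace =
      (P * (1 - D)).trace := by
  obtain ⟨hleft, hright⟩ := permOp_unitary (X := X) π
  have hD : 1 - permOp X π * D * (permOp X π)ᴴ = permOp X π * (1 - D) * (permOp X π)ᴴ := by
    rw [mul_sub, sub_mul, mul_one, hright]
  calc (permOp X π * P * (permOp X π)ᴴ * (1 - permOp X π * D * (permOp X π)ᴴ)).trace
      = (permOp X π * (P * ((permOp X π)ᴴ * permOp X π) * (1 - D)) * (permOp X π)ᴴ).trace := by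
        rw [hD]
        simp only [mul_assoc]
    _ = (P * (1 - D)).trace := by
        rw [hleft, mul_one, Matrix.trace_mul_comm, ← mul_assoc, hleft, one_mul]

/-- The average of a state over all permutations of the tensor factors. -/
def State.twirl (ζ : State (Pow X ℓ)) : State (Pow X ℓ) where
  op := (ℓ ! : ℂ)⁻¹ • ∑ π : Equiv.Perm (Fin ℓ), (ζ.permute π⁻¹).op
  posSemidef := (Matrix.posSemidef_sum _ fun π _ => (ζ.permute π⁻¹).posSemidef).smul
    (inv_nonneg.mpr (Nat.cast_nonneg _))
  trace_eq_one := by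
    simp only [Matrix.trace_smul, Matrix.trace_sum, State.trace_eq_one, sum_const, card_univ,
      Fintype.card_perm, Fintype.card_fin, smul_eq_mul, nsmul_eq_mul, mul_one]
    exact inv_mul_cancel₀ (Nat.cast_ne_zero.mpr ℓ.factorial_ne_zero)

theorem State.isPermInvariant_twirl (ζ : State (Pow X ℓ)) : IsPermInvariant ζ.twirl.op := by
  intro σ
  ext x y
  rw [permOp_conj_apply]
  simp only [State.twirl, State.permute, Matrix.smul_apply, Matrix.sum_apply, permOp_conj_apply,
    Function.comp_assoc]
  congr 1
  exact Fintype.sum_equiv (Equiv.mulRight σ⁻¹) _ _ fun π => rfl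

end Twirling

section ErrorFunctional

variable {A B J : Type*} [Fintype A] [Fintype B] [Fintype J]
  [DecidableEq A] [DecidableEq J] {ℓ M : ℕ}

theorem blockOutput_apply (N : Channel (A × J) B) (ρ : Op (Pow A ℓ)) (σ : Op (Pow J ℓ))
    (y y' : Pow B ℓ) : blockOutput N ρ σ y y' = ∑ u : Pow (A × J) ℓ, ∑ u' : Pow (A × J) ℓ,
      ρ (Prod.fst ∘ u) (Prod.fst ∘ u') * σ (Prod.snd ∘ u) (Prod.snd ∘ u') *
        ∏ i, N.map (Matrix.single (u i) (u' i) 1) (y i) (y' i) :=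
  rfl

theorem blockOutput_posSemidef (N : Channel (A × J) B) {ρ : Op (Pow A ℓ)} {σ : Op (Pow J ℓ)}
    (hρ : ρ.PosSemidef) (hσ : σ.PosSemidef) : (blockOutput N ρ σ).PosSemidef :=
  tensorPowMap_posSemidef N.completelyPositive ((hρ.kronecker hσ).submatrix _)

variable [DecidableEq B]

theorem blockOutput_permOp_conj (N : Channel (A × J) B) (ρ : Op (Pow A ℓ)) (σ : Op (Pow J ℓ))
    (π : Equiv.Perm (Fin ℓ)) :
    blockOutput N (permOp A π * ρ * (permOp A π)ᴴ) (permOp J π * σ * (permOp J π)ᴴ) =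
      permOp B π * blockOutput N ρ σ * (permOp B π)ᴴ := by
  ext y y'
  rw [permOp_conj_apply, blockOutput_apply, blockOutput_apply]
  simp only [permOp_conj_apply]
  let e : Pow (A × J) ℓ ≃ Pow (A × J) ℓ := π⁻¹.arrowCongr (Equiv.refl _)
  refine Fintype.sum_equiv e _ _ fun u => Fintype.sum_equiv e _ _ fun u' => ?_
  congr 1
  exact (Equiv.prod_comp π fun i => N.map (Matrix.single (u i) (u' i) 1) (y i) (y' i)).symm

omit [DecidableEq A] in
theorem Code.one_sub_dec_posSemidef (C : Code A B ℓ M) (m : Fin M) :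
    (1 - C.dec m).PosSemidef := by
  have hsum : 1 - C.dec m = ∑ m' ∈ univ.erase m, C.dec m' := by
    rw [← C.dec_sum, sub_eq_iff_eq_add, sum_erase_add _ _ (mem_univ m)]
  rw [hsum]
  exact Matrix.posSemidef_sum _ fun m' _ => C.dec_posSemidef m'

/-- The error probability of a code as a positive linear functional of the jammer's operator. -/
def errorFunctional (N : Channel (A × J) B) (C : Code A B ℓ M) : Op (Pow J ℓ) →ₚ[ℂ] ℂ :=
  .mk₀
    { toFun σ := ((1 / (M : ℝ) : ℝ) : ℂ) *
        ∑ m, (blockOutput N (C.enc m).op σ * (1 - C.dec m)).trace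
      map_add' σ τ := by
        simp only [blockOutput, Matrix.kronecker_add, Matrix.reindex_apply, Matrix.submatrix_add,
          Pi.add_apply, map_add, add_mul, Matrix.trace_add, sum_add_distrib, mul_add]
      map_smul' c σ := by
        simp only [blockOutput, Matrix.kronecker_smul, Matrix.reindex_apply,
          Matrix.submatrix_smul, Pi.smul_apply, map_smul, smul_mul_assoc, Matrix.trace_smul,
          ← smul_sum, mul_smul_comm, RingHom.id_apply] }
    fun _ hP => mul_nonneg (Complex.zero_le_real.mpr (by positivity)) <| sum_nonneg fun m _ =>
      trace_mul_nonneg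
        (blockOutput_posSemidef N (C.enc m).posSemidef (Matrix.nonneg_iff_posSemidef.mp hP))
        (C.one_sub_dec_posSemidef m)

theorem errorFunctional_apply (N : Channel (A × J) B) (C : Code A B ℓ M) (σ : Op (Pow J ℓ)) :
    errorFunctional N C σ = ((1 / (M : ℝ) : ℝ) : ℂ) *
      ∑ m, (blockOutput N (C.enc m).op σ * (1 - C.dec m)).trace :=
  rfl

theorem errorFunctional_re (N : Channel (A × J) B) (C : Code A B ℓ M) (σ : State (Pow J ℓ)) :
    (errorFunctional N C σ.op).re = errorProb N C σ := by
  rw [errorFunctional_apply, Complex.re_ofReal_mul, Complex.re_sum, errorProb]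

theorem errorProb_permute (N : Channel (A × J) B) (C : Code A B ℓ M) (π : Equiv.Perm (Fin ℓ))
    (ζ : State (Pow J ℓ)) :
    errorProb N (C.permute π) ζ = errorProb N C (ζ.permute π⁻¹) := by
  have htrace : ∀ m, (blockOutput N ((C.permute π).enc m).op ζ.op *
      (1 - (C.permute π).dec m)).trace =
      (blockOutput N (C.enc m).op (ζ.permute π⁻¹).op * (1 - C.dec m)).trace := fun m => by
    rw [← trace_permOp_conj_mul_one_sub π (blockOutput N (C.enc m).op _),
      ← blockOutput_permOp_conj]
    simp only [State.permute, permOp_conj_permOp_inv_conj, Code.permute]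
  simp only [errorProb, htrace]

theorem errorProb_twirl (N : Channel (A × J) B) (C : Code A B ℓ M) (ζ : State (Pow J ℓ)) :
    errorProb N C ζ.twirl =
      (ℓ ! : ℝ)⁻¹ * ∑ π : Equiv.Perm (Fin ℓ), errorProb N C (ζ.permute π⁻¹) := by
  simp only [← errorFunctional_re, State.twirl, map_smul, map_sum, smul_eq_mul,
    ← Complex.ofReal_natCast, ← Complex.ofReal_inv, Complex.re_ofReal_mul, Complex.re_sum]

theorem randomPermute_errorProb (N : Channel (A × J) B) (C : Code A B ℓ M)
    (ζ : State (Pow J ℓ)) :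
    C.randomPermute.errorProb N ζ = errorProb N C ζ.twirl := by
  simp only [RandomCode.errorProb, Code.randomPermute, errorProb_permute, errorProb_twirl,
    PMF.uniformOfFintype_apply, Fintype.card_perm, Fintype.card_fin, ENNReal.toReal_inv,
    ENNReal.toReal_natCast, mul_sum]

omit [DecidableEq J] in
theorem HasCompoundError.nonneg [Nonempty J] {N : Channel (A × J) B} {C : Code A B ℓ M} {ε : ℝ}
    (hC : HasCompoundError N C ε) : 0 ≤ ε := by
  classical
  obtain ⟨σ⟩ : Nonempty (State J) := inferInstance
  refine le_trans ?_ (hC σ)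
  rw [← errorProb_pow, ← errorFunctional_re]
  exact (Complex.nonneg_iff.mp
    (map_nonneg (errorFunctional N C) (σ.pow ℓ).posSemidef.nonneg)).1

end ErrorFunctional

end

end QAVC

theorem proposition2 {A B J : Type*} [Fintype A] [Fintype B] [Fintype J]
    [DecidableEq A] [DecidableEq B] [DecidableEq J] [Nonempty J]
    (N : QAVC.Channel (A × J) B) (ℓ M : ℕ) (C : QAVC.Code A B ℓ M) (ε : ℝ)
    (hC : QAVC.HasCompoundError N C ε) (ζ : QAVC.State (QAVC.Pow J ℓ)) :
    C.randomPermute.errorProb N ζ ≤ ε * ((ℓ : ℝ) + 1) ^ (Fintype.card J ^ 2) := by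
  rw [QAVC.randomPermute_errorProb, ← QAVC.errorFunctional_re]
  refine (ζ.isPermInvariant_twirl.functional_le (ε := ε) fun σ => ?_).trans
    (mul_le_mul_of_nonneg_left ?_ hC.nonneg)
  · rw [QAVC.errorFunctional_re, QAVC.errorProb_pow]
    exact hC σ
  · have hdim := QAVC.card_image_occ_le (ι := Fin ℓ) (K := J × J)
    rw [Fintype.card_fin, Fintype.card_prod, ← sq] at hdim
    exact_mod_cast hdim
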